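/- Fix an interest rate $r>0$, a liquid asset with drift $\mu\in\mathbb R$ and volatility $\sigma>0$, an illiquid asset with drift $\alpha\in\mathbb R$ and volatility $\eta>0$, a correlation $\rho\in(-1,1)$, proportional transaction costs $\lambda\ge 0$ on purchases and $\gamma\in[0,1)$ on sales of the illiquid asset with $\lambda+\gamma>0$, a risk aversion $R\in(0,\infty)\setminus\{1\}$ and a discount rate $\delta\in\mathbb R$. Put $\beta=\frac{\mu-r}{\sigma}$, $\nu=\frac{\alpha-r}{\eta}$, $\xi=\frac{\lambda+\gamma}{1-\gamma}$ and $$b_1=\frac{2\left[\delta-r(1-R)-\frac{\beta^2(1-R)}{2R}\right]}{\eta^2(1-\rho^2)},\quad b_2=\frac{\beta^2-2R\eta\rho\beta+\eta^2R^2}{\eta^2R^2(1-\rho^2)},\quad b_3=\frac{2(\nu-\beta\rho)}{\eta(1-\rho^2)},$$ and assume $b_1>0$, $b_2>1$, $b_3>0$. Let $$m(q)=\frac{R(1-R)}{b_1}q^2-\frac{b_3(1-R)}{b_1}q+1,$$ $$\ell(q)=m(q)+\frac{1-R}{b_1}q(1-q)+\frac{(b_2-1)R(1-R)}{b_1}\,\frac{q}{(1-R)q+R},$$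 $$\varphi(q,n)=b_1(n-1)+(1-R)(b_3-2R)q+(2-b_2)R(1-R),\qquad E(q)^2=4R^2(1-R)^2(b_2-1)(1-q)^2,$$ $$O(q,n)=\frac{(1-R)n}{R(1-q)}-\frac{2(1-R)^2qn/R}{2(1-R)(1-q)[(1-R)q+R]-\varphi(q,n)-\operatorname{sgn}(1-R)\sqrt{\varphi(q,n)^2+E(q)^2}}$$ for $q\ne1$ with non-zero denominator, and $O(1,n)=\lim_{q\to1}O(q,n)$ for $(1-R)n<(1-R)\ell(1)$. A solution of the free boundary value problem is a triple $(n,q_*,q^*)$ with $0<q_*<q^*$ and $n$ positive and differentiable on $[q_*,q^*]$, such that for every $q\in[q_*,q^*]$ the value $O(q,n(q))$ is defined and $n'(q)=O(q,n(q))$, and $$n(q_*)=m(q_*),\quad n(q^*)=m(q^*),\quad \ln(1+\xi)=\int_{q_*}^{q^*}\left(-\frac{R}{q(1-R)}\,\frac{O(q,n(q))}{n(q)}\right)dq .$$ The critical ratios (of wealth in the illiquid asset to paper wealth, at which the illiquid asset is bought and sold respectively) are $$p_*=\frac{q_*}{1+\lambda(1-q_*)},\qquad p^*=\frac{q^*}{1-\gamma(1-q^*)}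 .$$ **Corollary.** Consider parameters for which these assumptions hold and the free boundary value problem has a solution. With all other primitive parameters fixed: 1. $p_*$ and $p^*$ are strictly decreasing in $\delta$: if $\delta_1<\delta_2$ are two such discount rates, the critical ratios for $\delta_2$ are strictly smaller than the respective ones for $\delta_1$. 2. If $R<1$, then $p_*$ and $p^*$ are strictly increasing in $\alpha$: if $\alpha_1<\alpha_2$ are two such drifts, the critical ratios for $\alpha_2$ are strictly larger than the respective ones for $\alpha_1$. -/

import Mathlib

open Filter Topology

namespace IlliquidAsset

/-- The primitive parameters: risk aversion `R`, discount rate `δ`, interest rate `r`, drift `μ` and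
volatility `σ` of the liquid asset, drift `α` and volatility `η` of the illiquid asset, correlation `ρ`,
and the proportional transaction costs `lam` (on purchases) and `γ` (on sales) of the illiquid asset. -/
structure Params where
  R : ℝ
  δ : ℝ
  r : ℝ
  μ : ℝ
  σ : ℝ
  α : ℝ
  η : ℝ
  ρ : ℝ
  lam : ℝ
  γ : ℝ

namespace Params

noncomputable section

variable (P : Params)

/-- Sharpe ratio of the liquid asset. -/
def β : ℝ := (P.μ - P.r) / P.σ

/-- Sharpe ratio of the illiquid asset. -/
def ν : ℝ := (P.α - P.r) / P.η

def b₁ : ℝ :=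
  2 * (P.δ - P.r * (1 - P.R) - P.β ^ 2 * (1 - P.R) / (2 * P.R)) / (P.η ^ 2 * (1 - P.ρ ^ 2))

def b₂ : ℝ :=
  (P.β ^ 2 - 2 * P.R * P.η * P.ρ * P.β + P.η ^ 2 * P.R ^ 2) / (P.η ^ 2 * P.R ^ 2 * (1 - P.ρ ^ 2))

def b₃ : ℝ := 2 * (P.ν - P.β * P.ρ) / (P.η * (1 - P.ρ ^ 2))

/-- The round-trip transaction cost. -/
def ξ : ℝ := (P.lam + P.γ) / (1 - P.γ)

/-- The ranges of the primitive parameters, and the standing assumption on the auxiliary ones. -/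
structure Standing : Prop where
  R_pos : 0 < P.R
  R_ne_one : P.R ≠ 1
  r_pos : 0 < P.r
  σ_pos : 0 < P.σ
  η_pos : 0 < P.η
  ρ_gt : -1 < P.ρ
  ρ_lt : P.ρ < 1
  lam_nonneg : 0 ≤ P.lam
  γ_nonneg : 0 ≤ P.γ
  γ_lt : P.γ < 1
  cost_pos : 0 < P.lam + P.γ
  b₁_pos : 0 < P.b₁
  b₂_gt : 1 < P.b₂
  b₃_pos : 0 < P.b₃

/-- The quadratic `m`. -/
def m (q : ℝ) : ℝ :=
  P.R * (1 - P.R) / P.b₁ * q ^ 2 - P.b₃ * (1 - P.R) / P.b₁ * q + 1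

/-- The algebraic function `ℓ`. -/
def ell (q : ℝ) : ℝ :=
  P.m q + (1 - P.R) / P.b₁ * q * (1 - q)
    + (P.b₂ - 1) * P.R * (1 - P.R) / P.b₁ * (q / ((1 - P.R) * q + P.R))

def φ (q n : ℝ) : ℝ :=
  P.b₁ * (n - 1) + (1 - P.R) * (P.b₃ - 2 * P.R) * q + (2 - P.b₂) * P.R * (1 - P.R)

/-- The quantity `E(q)²`. -/
def Esq (q : ℝ) : ℝ :=
  4 * P.R ^ 2 * (1 - P.R) ^ 2 * (P.b₂ - 1) * (1 - q) ^ 2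

/-- The denominator of the second fraction in the formula for `O`. -/
def denomO (q n : ℝ) : ℝ :=
  2 * (1 - P.R) * (1 - q) * ((1 - P.R) * q + P.R) - P.φ q n
    - Real.sign (1 - P.R) * Real.sqrt (P.φ q n ^ 2 + P.Esq q)

/-- The formula for `O(q,n)`, meaningful where `q ≠ 1` and the denominator does not vanish. -/
def formulaO (q n : ℝ) : ℝ :=
  (1 - P.R) * n / (P.R * (1 - q)) - 2 * (1 - P.R) ^ 2 * q * n / P.R / P.denomO q n

/-- The function `O`, extended to `q = 1` by continuity. -/
def O (q n : ℝ) : ℝ :=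
  open Classical in
  if q = 1 then limUnder (𝓝[≠] (1 : ℝ)) (fun x => P.formulaO x n) else P.formulaO q n

/-- The set of points `(q,n)` at which `O` is defined: off `q = 1` the denominator must not vanish;
on `q = 1` the extension by continuity exists for `(1 - R) n < (1 - R) ℓ(1)`. -/
def DefinedO (q n : ℝ) : Prop :=
  (q ≠ 1 ∧ P.denomO q n ≠ 0) ∨ (q = 1 ∧ (1 - P.R) * n < (1 - P.R) * P.ell 1)

/-- `(n, ql, qu)` solves the free boundary value problem: `n` is a positive solution of
`n' = O(q,n)` on `[ql, qu]` (one-sided derivatives at the end points) that meets the quadratic `m` at both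
end points, and the boundary points are consistent with the round-trip transaction cost. -/
structure IsFreeBoundarySolution (n : ℝ → ℝ) (ql qu : ℝ) : Prop where
  ql_pos : 0 < ql
  ql_lt_qu : ql < qu
  n_pos : ∀ q ∈ Set.Icc ql qu, 0 < n q
  definedO : ∀ q ∈ Set.Icc ql qu, P.DefinedO q (n q)
  ode : ∀ q ∈ Set.Icc ql qu, HasDerivWithinAt n (P.O q (n q)) (Set.Icc ql qu) q
  left_boundary : n ql = P.m ql
  right_boundary : n qu = P.m qu
  transaction_cost :
    Real.log (1 + P.ξ) = ∫ q in ql..qu, -(P.R / (q * (1 - P.R)) * (P.O q (n q) / n q))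

/-- `pl` and `pu` are the critical ratios `p_*` and `p^*` of illiquid wealth to paper wealth, at which the
illiquid asset is bought and sold respectively. -/
def IsCriticalRatios (pl pu : ℝ) : Prop :=
  ∃ (n : ℝ → ℝ) (ql qu : ℝ), P.IsFreeBoundarySolution n ql qu ∧
    pl = ql / (1 + P.lam * (1 - ql)) ∧ pu = qu / (1 - P.γ * (1 - qu))

end

end Params

end IlliquidAsset

/-! Write `y = b₁ (n - m) / (1 - R)`, `k = b₂ - 1`, `B = b₁`, `c = b₃`. The boundary conditions
become `y = 0` at both ends, and the square root in `O` is removed by a coordinate `Z`, strictly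
increasing in `y`, with `y = (1 - q)² Z / 2 + R k Z / (2R + Z)`. With `N = b₁ n` the equation reads
`y' = -(q / R) N rate(q, Z) - 2 R q + c`, the cost is `∫ rate`, and `rate` increases with `Z`; the
sign of `1 - R` survives only in `N = (1 - R)(y + R q² - c q) + B`.

A solution is positive inside its interval (`y_pos`). Take two solutions with `c₂ ≤ c₁` and `N₁ <
N₂` wherever `y₁ = y₂`. Then `y₁` can cross `y₂` only upwards (`no_crossing_right`,
`no_crossing_left`). If one pair of end points were in the wrong order, the intervals would be
nested and the solutions ordered on the smaller one. Equal cost then forces the solutions to agree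
there (`eqOn_of_nested`), which the two equations forbid (`not_eqOn`). So both end points move
strictly, and `q ↦ p` is increasing. -/

namespace IlliquidAsset

open Set

/-! ### Zeros of continuous functions and one-sided derivatives. -/

section RealAnalysis

lemma exists_last_zero {f : ℝ → ℝ} {a x : ℝ} (hax : a ≤ x) (hf : ContinuousOn f (Icc a x))
    (ha : 0 ≤ f a) (hx : f x < 0) : ∃ c ∈ Ico a x, f c = 0 ∧ ∀ t ∈ Ioc c x, f t < 0 := by
  have hcl : IsClosed (Icc a x ∩ f ⁻¹' Ici 0) := hf.preimage_isClosed_of_isClosed isClosed_Icc isClosed_Ici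
  have hK : IsCompact (Icc a x ∩ f ⁻¹' Ici 0) :=
    isCompact_Icc.of_isClosed_subset hcl inter_subset_left
  obtain ⟨c, ⟨hc, hc0⟩, hmax⟩ := hK.exists_isGreatest ⟨a, ⟨le_rfl, hax⟩, ha⟩
  have hc0 : 0 ≤ f c := hc0
  have hcx : c < x := lt_of_le_of_ne hc.2 (by rintro rfl; linarith)
  have hneg : ∀ t ∈ Ioc c x, f t < 0 := by
    intro t ht
    by_contra! h
    exact absurd (hmax ⟨⟨hc.1.trans ht.1.le, ht.2⟩, h⟩) (not_le.2 ht.1)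
  refine ⟨c, ⟨hc.1, hcx⟩, le_antisymm ?_ hc0, hneg⟩
  by_contra! hpos
  obtain ⟨t, ht, ht0⟩ := intermediate_value_Icc' hcx.le (hf.mono (Icc_subset_Icc_left hc.1))
    (show (0 : ℝ) ∈ Icc (f x) (f c) from ⟨hx.le, hc0⟩)
  have : c < t := lt_of_le_of_ne ht.1 (by rintro rfl; linarith)
  linarith [hneg t ⟨this, ht.2⟩]

lemma exists_first_zero {f : ℝ → ℝ} {x b : ℝ} (hxb : x ≤ b) (hf : ContinuousOn f (Icc x b))
    (hx : f x < 0) (hb : 0 ≤ f b) : ∃ e ∈ Ioc x b, f e = 0 ∧ ∀ t ∈ Ico x e, f t < 0 := by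
  obtain ⟨c, hc, hc0, h⟩ := exists_last_zero (f := fun t => f (-t)) (neg_le_neg hxb)
    (hf.comp continuous_neg.continuousOn fun t ht => ⟨by linarith [ht.2], by linarith [ht.1]⟩)
    (by simpa using hb) (by simpa using hx)
  refine ⟨-c, ⟨by linarith [hc.2], by linarith [hc.1]⟩, hc0, fun t ht => ?_⟩
  simpa using h (-t) ⟨by linarith [ht.2], by linarith [ht.1]⟩

lemma eventually_gt_right {f : ℝ → ℝ} {f' a b c : ℝ} (hf : HasDerivWithinAt f f' (Icc a b) c)
    (hc : c ∈ Ico a b) (h : 0 < f') : ∀ᶠ t in 𝓝[>] c, f c < f t := by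
  have h1 : HasDerivWithinAt f f' (Ioi c) c :=
    hf.mono_of_mem_nhdsWithin (mem_of_superset (Ioo_mem_nhdsGT hc.2)
      fun t ht => ⟨hc.1.trans ht.1.le, ht.2.le⟩)
  rw [hasDerivWithinAt_iff_tendsto_slope' (by simp)] at h1
  filter_upwards [h1.eventually (lt_mem_nhds h), self_mem_nhdsWithin] with t ht hct
  rw [slope_def_field] at ht
  have := (div_pos_iff_of_pos_right (sub_pos.2 hct)).1 ht
  linarith

lemma eventually_lt_left {f : ℝ → ℝ} {f' a b c : ℝ} (hf : HasDerivWithinAt f f' (Icc a b) c)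
    (hc : c ∈ Ioc a b) (h : 0 < f') : ∀ᶠ t in 𝓝[<] c, f t < f c := by
  have h1 : HasDerivWithinAt f f' (Iio c) c :=
    hf.mono_of_mem_nhdsWithin (mem_of_superset (Ioo_mem_nhdsLT hc.1)
      fun t ht => ⟨ht.1.le, ht.2.le.trans hc.2⟩)
  rw [hasDerivWithinAt_iff_tendsto_slope' (by simp)] at h1
  filter_upwards [h1.eventually (lt_mem_nhds h), self_mem_nhdsWithin] with t ht hct
  rw [slope_def_field] at ht
  have hct : t < c := hct
  by_contra! h2
  linarith [div_nonpos_of_nonneg_of_nonpos (sub_nonneg.2 h2) (sub_nonpos.2 hct.le)]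

end RealAnalysis

/-! ### The reduced free boundary value problem. -/

/-- The integrand of the transaction cost condition in terms of `z = Z(q)`. -/
noncomputable def rate (q z : ℝ) : ℝ := z / (q * (2 * q - (1 - q) * z))

/-- The free boundary value problem in the coordinates `y = b₁ (n - m) / (1 - R)` and `Z`, a
strictly increasing function of `y` for fixed `q`. -/
structure ReducedSolution (R k B c L : ℝ) (y Z : ℝ → ℝ) (a b : ℝ) : Prop where
  a_pos : 0 < a
  a_lt_b : a < b
  Z_cont : ContinuousOn Z (Icc a b)
  Z_gt : ∀ q ∈ Icc a b, 0 < 2 * R + Z q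
  rel : ∀ q ∈ Icc a b, y q = (1 - q) ^ 2 * Z q / 2 + R * k * (Z q / (2 * R + Z q))
  den_pos : ∀ q ∈ Icc a b, 0 < 2 * q - (1 - q) * Z q
  N_pos : ∀ q ∈ Icc a b, 0 < (1 - R) * (y q + R * q ^ 2 - c * q) + B
  deriv : ∀ q ∈ Icc a b, HasDerivWithinAt y
    (-(q / R * ((1 - R) * (y q + R * q ^ 2 - c * q) + B) * rate q (Z q)) - 2 * R * q + c)
    (Icc a b) q
  left : y a = 0
  right : y b = 0
  cost : L = ∫ q in a..b, rate q (Z q)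

lemma rate_sub {q z w : ℝ} (hq : 0 < q) (hz : 0 < 2 * q - (1 - q) * z)
    (hw : 0 < 2 * q - (1 - q) * w) :
    rate q z - rate q w =
      2 * (z - w) / ((2 * q - (1 - q) * z) * (2 * q - (1 - q) * w)) := by
  unfold rate
  rw [div_sub_div _ _ (by positivity) (by positivity), div_eq_div_iff (by positivity) (by positivity)]
  ring

lemma rate_lt_rate {q z w : ℝ} (hq : 0 < q) (hz : 0 < 2 * q - (1 - q) * z)
    (hw : 0 < 2 * q - (1 - q) * w) (h : z < w) : rate q z < rate q w := by
  have := rate_sub hq hw hz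
  have : 0 < rate q w - rate q z := by
    rw [this]; have := sub_pos.2 h; positivity
  linarith

lemma rate_zero (q : ℝ) : rate q 0 = 0 := by simp [rate]

/-- The last factor is positive, so `y` and `Z` are ordered alike; its second summand alone bounds
`Z` differences by `y` differences, even at `q = 1`. -/
lemma coord_sub {R k q z w : ℝ} (hz : 0 < 2 * R + z) (hw : 0 < 2 * R + w) :
    ((1 - q) ^ 2 * z / 2 + R * k * (z / (2 * R + z)))
      - ((1 - q) ^ 2 * w / 2 + R * k * (w / (2 * R + w)))
      = (z - w) * ((1 - q) ^ 2 / 2 + 2 * R ^ 2 * k / ((2 * R + z) * (2 * R + w))) := by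
  field_simp
  ring

namespace ReducedSolution

variable {R k B c L : ℝ} {y Z : ℝ → ℝ} {a b : ℝ}

lemma q_pos (h : ReducedSolution R k B c L y Z a b) {q : ℝ} (hq : q ∈ Icc a b) : 0 < q :=
  h.a_pos.trans_le hq.1

lemma y_cont (h : ReducedSolution R k B c L y Z a b) : ContinuousOn y (Icc a b) :=
  fun q hq => (h.deriv q hq).continuousWithinAt

lemma rate_cont (h : ReducedSolution R k B c L y Z a b) :
    ContinuousOn (fun q => rate q (Z q)) (Icc a b) := by
  unfold rate
  have hZ := h.Z_cont
  refine ContinuousOn.div hZ (by fun_prop) fun q hq => ?_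
  have := h.q_pos hq
  have := h.den_pos q hq
  positivity

end ReducedSolution

section Compare

variable {R k : ℝ} {B₁ c₁ L₁ B₂ c₂ L₂ : ℝ} {y₁ Z₁ y₂ Z₂ : ℝ → ℝ} {a₁ b₁ a₂ b₂ : ℝ}

lemma Z_lt_Z_iff (hR : 0 < R) (hk : 0 < k) (h₁ : ReducedSolution R k B₁ c₁ L₁ y₁ Z₁ a₁ b₁)
    (h₂ : ReducedSolution R k B₂ c₂ L₂ y₂ Z₂ a₂ b₂) {q : ℝ} (hq₁ : q ∈ Icc a₁ b₁)
    (hq₂ : q ∈ Icc a₂ b₂) : Z₁ q < Z₂ q ↔ y₁ q < y₂ q := by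
  have e₁ := h₁.Z_gt q hq₁
  have e₂ := h₂.Z_gt q hq₂
  have := coord_sub (k := k) (q := q) e₁ e₂
  rw [← h₁.rel q hq₁, ← h₂.rel q hq₂] at this
  have hp : 0 < (1 - q) ^ 2 / 2 + 2 * R ^ 2 * k / ((2 * R + Z₁ q) * (2 * R + Z₂ q)) := by
    positivity
  constructor
  · intro h
    nlinarith [mul_pos (sub_pos.2 h) hp]
  · intro h
    by_contra! h'
    nlinarith [mul_nonneg (sub_nonneg.2 h') hp.le]

lemma rate_lt_rate_of_lt (hR : 0 < R) (hk : 0 < k)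
    (h₁ : ReducedSolution R k B₁ c₁ L₁ y₁ Z₁ a₁ b₁)
    (h₂ : ReducedSolution R k B₂ c₂ L₂ y₂ Z₂ a₂ b₂) {q : ℝ} (hq₁ : q ∈ Icc a₁ b₁)
    (hq₂ : q ∈ Icc a₂ b₂) (h : y₁ q < y₂ q) : rate q (Z₁ q) < rate q (Z₂ q) :=
  rate_lt_rate (h₁.q_pos hq₁) (h₁.den_pos q hq₁) (h₂.den_pos q hq₂)
    ((Z_lt_Z_iff hR hk h₁ h₂ hq₁ hq₂).2 h)

lemma rate_eq_rate_of_eq (hR : 0 < R) (hk : 0 < k)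
    (h₁ : ReducedSolution R k B₁ c₁ L₁ y₁ Z₁ a₁ b₁)
    (h₂ : ReducedSolution R k B₂ c₂ L₂ y₂ Z₂ a₂ b₂) {q : ℝ} (hq₁ : q ∈ Icc a₁ b₁)
    (hq₂ : q ∈ Icc a₂ b₂) (h : y₁ q = y₂ q) : rate q (Z₁ q) = rate q (Z₂ q) := by
  have e₁ := (Z_lt_Z_iff hR hk h₁ h₂ hq₁ hq₂).not.2 h.not_lt
  have e₂ := (Z_lt_Z_iff hR hk h₂ h₁ hq₂ hq₁).not.2 h.not_gt
  rw [le_antisymm (not_lt.1 e₂) (not_lt.1 e₁)]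

lemma rate_le_rate_of_le (hR : 0 < R) (hk : 0 < k)
    (h₁ : ReducedSolution R k B₁ c₁ L₁ y₁ Z₁ a₁ b₁)
    (h₂ : ReducedSolution R k B₂ c₂ L₂ y₂ Z₂ a₂ b₂) {q : ℝ} (hq₁ : q ∈ Icc a₁ b₁)
    (hq₂ : q ∈ Icc a₂ b₂) (h : y₁ q ≤ y₂ q) : rate q (Z₁ q) ≤ rate q (Z₂ q) := by
  rcases h.lt_or_eq with h | h
  · exact (rate_lt_rate_of_lt hR hk h₁ h₂ hq₁ hq₂ h).le
  · exact (rate_eq_rate_of_eq hR hk h₁ h₂ hq₁ hq₂ h).le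

end Compare

/-! ### Sign and end points of a single solution. -/

namespace ReducedSolution

variable {R k B c L : ℝ} {y Z : ℝ → ℝ} {a b : ℝ}

lemma Z_pos_iff (hR : 0 < R) (hk : 0 < k) (h : ReducedSolution R k B c L y Z a b) {q : ℝ}
    (hq : q ∈ Icc a b) : 0 < Z q ↔ 0 < y q := by
  have e := h.Z_gt q hq
  have : y q = Z q * ((1 - q) ^ 2 / 2 + R * k / (2 * R + Z q)) := by
    rw [h.rel q hq]; ring
  have hp : 0 < (1 - q) ^ 2 / 2 + R * k / (2 * R + Z q) := by positivity
  rw [this, mul_pos_iff_of_pos_right hp]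

lemma Z_neg_iff (hR : 0 < R) (hk : 0 < k) (h : ReducedSolution R k B c L y Z a b) {q : ℝ}
    (hq : q ∈ Icc a b) : Z q < 0 ↔ y q < 0 := by
  have e := h.Z_gt q hq
  have : y q = Z q * ((1 - q) ^ 2 / 2 + R * k / (2 * R + Z q)) := by
    rw [h.rel q hq]; ring
  have hp : 0 < (1 - q) ^ 2 / 2 + R * k / (2 * R + Z q) := by positivity
  rw [this]
  exact ⟨fun h => mul_neg_of_neg_of_pos h hp, fun h => by
    by_contra! h'
    linarith [mul_nonneg h' hp.le]⟩

lemma rate_pos (hR : 0 < R) (hk : 0 < k) (h : ReducedSolution R k B c L y Z a b) {q : ℝ}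
    (hq : q ∈ Icc a b) (hy : 0 < y q) : 0 < rate q (Z q) := by
  have := h.q_pos hq
  have := h.den_pos q hq
  have := (h.Z_pos_iff hR hk hq).2 hy
  unfold rate
  positivity

lemma rate_nonneg (hR : 0 < R) (hk : 0 < k) (h : ReducedSolution R k B c L y Z a b) {q : ℝ}
    (hq : q ∈ Icc a b) (hy : 0 ≤ y q) : 0 ≤ rate q (Z q) := by
  have := h.q_pos hq
  have := h.den_pos q hq
  have : 0 ≤ Z q := not_lt.1 ((h.Z_neg_iff hR hk hq).not.2 (not_lt.2 hy))
  unfold rate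
  positivity

lemma rate_eq_zero (hR : 0 < R) (hk : 0 < k) (h : ReducedSolution R k B c L y Z a b) {q : ℝ}
    (hq : q ∈ Icc a b) (hy : y q = 0) : rate q (Z q) = 0 := by
  have h1 : 0 ≤ Z q := not_lt.1 ((h.Z_neg_iff hR hk hq).not.2 (not_lt.2 hy.ge))
  have h2 : Z q ≤ 0 := not_lt.1 ((h.Z_pos_iff hR hk hq).not.2 (not_lt.2 hy.le))
  rw [le_antisymm h2 h1, rate_zero]

lemma deriv_at_zero (hR : 0 < R) (hk : 0 < k) (h : ReducedSolution R k B c L y Z a b) {q : ℝ}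
    (hq : q ∈ Icc a b) (hy : y q = 0) :
    HasDerivWithinAt y (c - 2 * R * q) (Icc a b) q := by
  refine (h.deriv q hq).congr_deriv ?_
  rw [h.rate_eq_zero hR hk hq hy]
  ring

/-- At a zero the slope of `y` is `c - 2 R q`. An excursion below zero from `s` to `t > s` would
need `c ≤ 2 R s` and `2 R t ≤ c`. -/
lemma y_nonneg (hR : 0 < R) (hk : 0 < k) (h : ReducedSolution R k B c L y Z a b) {q : ℝ}
    (hq : q ∈ Icc a b) : 0 ≤ y q := by
  by_contra! hneg
  obtain ⟨s, hs, hs0, hs'⟩ := exists_last_zero hq.1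
    (h.y_cont.mono (Icc_subset_Icc_right hq.2)) h.left.ge hneg
  obtain ⟨t, ht, ht0, ht'⟩ := exists_first_zero hq.2
    (h.y_cont.mono (Icc_subset_Icc_left hq.1)) hneg h.right.ge
  have hsI : s ∈ Icc a b := ⟨hs.1, hs.2.le.trans hq.2⟩
  have htI : t ∈ Icc a b := ⟨hq.1.trans ht.1.le, ht.2⟩
  have h1 : c - 2 * R * s ≤ 0 := by
    by_contra! hpos
    have e1 := eventually_gt_right (h.deriv_at_zero hR hk hsI hs0) ⟨hs.1, hs.2.trans_le hq.2⟩ hpos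
    obtain ⟨x, hx1, hx2⟩ := (e1.and (Ioo_mem_nhdsGT hs.2)).exists
    linarith [hs' x ⟨hx2.1, hx2.2.le⟩]
  have h2 : 0 < -(c - 2 * R * t) := by
    nlinarith [hs.2, ht.1]
  have e2 := eventually_lt_left (h.deriv_at_zero hR hk htI ht0).neg ⟨hq.1.trans_lt ht.1, ht.2⟩ h2
  obtain ⟨x, hx1, hx2⟩ := (e2.and (Ioo_mem_nhdsLT ht.1)).exists
  have := ht' x ⟨hx2.1.le, hx2.2⟩
  simp only [Pi.neg_apply] at hx1
  linarith

/-- Once `2 R q ≥ c`, the derivative is negative from there on, so `y` could not return to zero at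
`b`. -/
lemma lt_of_zero (hR : 0 < R) (hk : 0 < k) (h : ReducedSolution R k B c L y Z a b) {q : ℝ}
    (hq : q ∈ Ico a b) (hy : y q = 0) : 2 * R * q < c := by
  by_contra! hc
  have hanti : StrictAntiOn y (Icc q b) := by
    refine strictAntiOn_of_deriv_neg (convex_Icc _ _)
      (h.y_cont.mono (Icc_subset_Icc_left hq.1)) fun x hx => ?_
    rw [interior_Icc] at hx
    have hxI : x ∈ Icc a b := ⟨hq.1.trans hx.1.le, hx.2.le⟩
    have hd := (h.deriv x hxI).hasDerivAt (Icc_mem_nhds (hq.1.trans_lt hx.1) hx.2)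
    rw [hd.deriv]
    have h1 := h.rate_nonneg hR hk hxI (h.y_nonneg hR hk hxI)
    have h2 := h.N_pos x hxI
    have h3 := h.q_pos hxI
    have : 0 ≤ x / R * ((1 - R) * (y x + R * x ^ 2 - c * x) + B) * rate x (Z x) := by positivity
    nlinarith [hx.1]
  have := hanti (left_mem_Icc.2 hq.2.le) (right_mem_Icc.2 hq.2.le) hq.2
  linarith [h.right]

lemma left_lt (hR : 0 < R) (hk : 0 < k) (h : ReducedSolution R k B c L y Z a b) :
    2 * R * a < c :=
  h.lt_of_zero hR hk ⟨le_rfl, h.a_lt_b⟩ h.left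

lemma le_right (hR : 0 < R) (hk : 0 < k) (h : ReducedSolution R k B c L y Z a b) :
    c ≤ 2 * R * b := by
  by_contra! hc
  have e2 := eventually_lt_left
    (h.deriv_at_zero hR hk (right_mem_Icc.2 h.a_lt_b.le) h.right) ⟨h.a_lt_b, le_rfl⟩ (sub_pos.2 hc)
  obtain ⟨x, hx1, hx2⟩ := (e2.and (Ioo_mem_nhdsLT h.a_lt_b)).exists
  linarith [h.y_nonneg hR hk ⟨hx2.1.le, hx2.2.le⟩, h.right]

lemma y_pos (hR : 0 < R) (hk : 0 < k) (h : ReducedSolution R k B c L y Z a b) {q : ℝ}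
    (hq : q ∈ Ioo a b) : 0 < y q := by
  have hqI := Ioo_subset_Icc_self hq
  refine lt_of_le_of_ne (h.y_nonneg hR hk hqI) fun h0 => ?_
  have h1 := h.lt_of_zero hR hk ⟨hq.1.le, hq.2⟩ h0.symm
  have e2 := eventually_lt_left
    (h.deriv_at_zero hR hk hqI h0.symm) ⟨hq.1, hq.2.le⟩ (sub_pos.2 h1)
  obtain ⟨x, hx1, hx2⟩ := (e2.and (Ioo_mem_nhdsLT hq.1)).exists
  linarith [h.y_nonneg hR hk ⟨hx2.1.le, hx2.2.le.trans hq.2.le⟩]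

/-- A solution that starts to the right of `1` bounds the transaction cost. -/
lemma log_cost_lt (h : ReducedSolution R k B c L y Z a b)
    (ha : 1 < a) : L < Real.log (a / (a - 1)) := by
  have hb : 1 < b := ha.trans h.a_lt_b
  -- For `q > 1` the rate is at most `1 / (q (q - 1))`, its limit as `Z → ∞`, with antiderivative
  -- `log ((q - 1) / q)`.
  have hI : ∫ q in a..b, 1 / (q * (q - 1)) = Real.log ((b - 1) / b) - Real.log ((a - 1) / a) := by
    rw [Real.log_div (by linarith) (by linarith), Real.log_div (by linarith) (by linarith)]
    have hd : ∀ q ∈ uIcc a b, HasDerivAt (fun q => Real.log (q - 1) - Real.log q)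
        (1 / (q * (q - 1))) q := by
      intro q hq
      rw [uIcc_of_le h.a_lt_b.le] at hq
      have h1 : q - 1 ≠ 0 := by linarith [hq.1]
      have h2 : q ≠ 0 := by linarith [hq.1]
      refine ((((hasDerivAt_id q).sub_const 1).log h1).sub (Real.hasDerivAt_log h2)).congr_deriv ?_
      simp only [id]
      field_simp
      ring
    rw [intervalIntegral.integral_eq_sub_of_hasDerivAt hd]
    refine ContinuousOn.intervalIntegrable (ContinuousOn.div (by fun_prop) (by fun_prop) ?_)
    intro q hq
    rw [uIcc_of_le h.a_lt_b.le] at hq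
    have h1 : 0 < q - 1 := by linarith [hq.1]
    have h2 : 0 < q := by linarith [hq.1]
    positivity
  have hle : L ≤ ∫ q in a..b, 1 / (q * (q - 1)) := by
    rw [h.cost]
    refine intervalIntegral.integral_mono_on h.a_lt_b.le
      (h.rate_cont.intervalIntegrable_of_Icc h.a_lt_b.le) ?_ fun q hq => ?_
    · refine ContinuousOn.intervalIntegrable (ContinuousOn.div (by fun_prop) (by fun_prop) ?_)
      intro q hq
      rw [uIcc_of_le h.a_lt_b.le] at hq
      have h1 : 0 < q - 1 := by linarith [hq.1]
      have h2 : 0 < q := by linarith [hq.1]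
      positivity
    · have h1 : 0 < q - 1 := by linarith [hq.1]
      have h2 : 0 < q := by linarith [hq.1]
      have h3 := h.den_pos q hq
      unfold rate
      rw [div_le_div_iff₀ (by positivity) (by positivity)]
      nlinarith [mul_pos h2 h2]
  have h1 : Real.log ((b - 1) / b) < 0 :=
    Real.log_neg (div_pos (by linarith) (by linarith)) ((div_lt_one (by linarith)).2 (by linarith))
  have h2 : Real.log (a / (a - 1)) = -Real.log ((a - 1) / a) := by
    rw [← Real.log_inv, inv_div]
  linarith

end ReducedSolution

/-! ### Comparison of two solutions with equal cost. -/

section Compare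

variable {R k L : ℝ} {B₁ c₁ B₂ c₂ : ℝ} {y₁ Z₁ y₂ Z₂ : ℝ → ℝ} {a₁ b₁ a₂ b₂ : ℝ}

lemma hasDerivAt_sub (h₁ : ReducedSolution R k B₁ c₁ L y₁ Z₁ a₁ b₁)
    (h₂ : ReducedSolution R k B₂ c₂ L y₂ Z₂ a₂ b₂) {q : ℝ} (hq₁ : q ∈ Ioo a₁ b₁)
    (hq₂ : q ∈ Ioo a₂ b₂) : HasDerivAt (fun q => y₁ q - y₂ q)
      (q / R * (((1 - R) * (y₂ q + R * q ^ 2 - c₂ * q) + B₂) * rate q (Z₂ q)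
        - ((1 - R) * (y₁ q + R * q ^ 2 - c₁ * q) + B₁) * rate q (Z₁ q)) + (c₁ - c₂)) q := by
  have d₁ := (h₁.deriv q (Ioo_subset_Icc_self hq₁)).hasDerivAt (Icc_mem_nhds hq₁.1 hq₁.2)
  have d₂ := (h₂.deriv q (Ioo_subset_Icc_self hq₂)).hasDerivAt (Icc_mem_nhds hq₂.1 hq₂.2)
  exact (d₁.sub d₂).congr_deriv (by ring)

/-- Where two solutions meet, the two values of `b₁ n` are ordered strictly. -/
lemma eventually_N_lt (h₁ : ReducedSolution R k B₁ c₁ L y₁ Z₁ a₁ b₁)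
    (h₂ : ReducedSolution R k B₂ c₂ L y₂ Z₂ a₂ b₂)
    (hB : ∀ q > 0, 0 < (1 - R) * (c₁ - c₂) * q + (B₂ - B₁)) {q : ℝ}
    (hq₁ : q ∈ Icc a₁ b₁) (hq₂ : q ∈ Icc a₂ b₂) (hy : y₁ q = y₂ q) :
    ∀ᶠ t in 𝓝[Icc a₁ b₁ ∩ Icc a₂ b₂] q,
      (1 - R) * (y₁ t + R * t ^ 2 - c₁ * t) + B₁ < (1 - R) * (y₂ t + R * t ^ 2 - c₂ * t) + B₂ := by
  have e₁ : ContinuousWithinAt y₁ (Icc a₁ b₁ ∩ Icc a₂ b₂) q :=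
    (h₁.y_cont q hq₁).mono inter_subset_left
  have e₂ : ContinuousWithinAt y₂ (Icc a₁ b₁ ∩ Icc a₂ b₂) q :=
    (h₂.y_cont q hq₂).mono inter_subset_right
  have f₁ : ContinuousWithinAt (fun t => (1 - R) * (y₁ t + R * t ^ 2 - c₁ * t) + B₁)
    (Icc a₁ b₁ ∩ Icc a₂ b₂) q := by fun_prop
  have f₂ : ContinuousWithinAt (fun t => (1 - R) * (y₂ t + R * t ^ 2 - c₂ * t) + B₂)
    (Icc a₁ b₁ ∩ Icc a₂ b₂) q := by fun_prop
  refine f₁.eventually_lt f₂ ?_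
  have := hB q (h₁.q_pos hq₁)
  simp only [hy]
  linarith

/-- The first solution cannot drop below the second one to the right of a meeting point. -/
lemma no_crossing_right (hR : 0 < R) (hk : 0 < k) (h₁ : ReducedSolution R k B₁ c₁ L y₁ Z₁ a₁ b₁)
    (h₂ : ReducedSolution R k B₂ c₂ L y₂ Z₂ a₂ b₂) (hc : c₂ ≤ c₁)
    (hB : ∀ q > 0, 0 < (1 - R) * (c₁ - c₂) * q + (B₂ - B₁)) {s x : ℝ} (hsx : s < x)
    (hs₁ : a₁ ≤ s) (hs₂ : a₂ ≤ s) (hx₁ : x ≤ b₁) (hx₂ : x ≤ b₂) (hs : y₁ s = y₂ s)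
    (hlt : ∀ t ∈ Ioc s x, y₁ t < y₂ t) : False := by
  have ev := eventually_N_lt h₁ h₂ hB ⟨hs₁, hsx.le.trans hx₁⟩ ⟨hs₂, hsx.le.trans hx₂⟩ hs
  have ev' : ∀ᶠ t in 𝓝[>] s, (1 - R) * (y₁ t + R * t ^ 2 - c₁ * t) + B₁
      < (1 - R) * (y₂ t + R * t ^ 2 - c₂ * t) + B₂ := by
    refine ev.filter_mono (nhdsWithin_le_of_mem (mem_of_superset (Ioo_mem_nhdsGT hsx) ?_))
    exact fun t ht => ⟨⟨hs₁.trans ht.1.le, ht.2.le.trans hx₁⟩, hs₂.trans ht.1.le, ht.2.le.trans hx₂⟩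
  obtain ⟨u, hu, huN⟩ := (mem_nhdsGT_iff_exists_Ioo_subset' hsx).1 ev'
  have hu : s < u := hu
  set v := min u x with hv
  have hsv : s < v := lt_min hu hsx
  have hvx : v ≤ x := min_le_right _ _
  -- The slope at `s` itself may be zero: at `y = 0` both rates vanish. To the right, `N₁ < N₂` and
  -- the rates are ordered the same way, so the difference grows.
  have hmono : StrictMonoOn (fun q => y₁ q - y₂ q) (Icc s v) := by
    refine strictMonoOn_of_deriv_pos (convex_Icc _ _) ?_ fun t ht => ?_
    · exact (h₁.y_cont.mono (Icc_subset_Icc hs₁ (hvx.trans hx₁))).sub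
        (h₂.y_cont.mono (Icc_subset_Icc hs₂ (hvx.trans hx₂)))
    · rw [interior_Icc] at ht
      have ht₁ : t ∈ Ioo a₁ b₁ := ⟨hs₁.trans_lt ht.1, ht.2.trans_le (hvx.trans hx₁)⟩
      have ht₂ : t ∈ Ioo a₂ b₂ := ⟨hs₂.trans_lt ht.1, ht.2.trans_le (hvx.trans hx₂)⟩
      rw [(hasDerivAt_sub h₁ h₂ ht₁ ht₂).deriv]
      have i₁ := Ioo_subset_Icc_self ht₁
      have i₂ := Ioo_subset_Icc_self ht₂
      have hN := huN ⟨ht.1, ht.2.trans_le (min_le_left _ _)⟩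
      have hr := rate_lt_rate_of_lt hR hk h₁ h₂ i₁ i₂ (hlt t ⟨ht.1, ht.2.le.trans hvx⟩)
      have hr1 := h₁.rate_nonneg hR hk i₁ (h₁.y_nonneg hR hk i₁)
      have hq := h₁.q_pos i₁
      have hN2 := h₂.N_pos t i₂
      simp only [mem_ofPred_eq] at hN
      have := mul_lt_mul' hN.le hr hr1 hN2
      have := mul_pos (div_pos hq hR) (sub_pos.2 this)
      linarith
  have := hmono (left_mem_Icc.2 hsv.le) (right_mem_Icc.2 hsv.le) hsv
  have h3 := hlt v ⟨hsv, hvx⟩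
  simp only at this
  linarith

/-- The first solution cannot lie above the second one to the left of a meeting point. -/
lemma no_crossing_left (hR : 0 < R) (hk : 0 < k) (h₁ : ReducedSolution R k B₁ c₁ L y₁ Z₁ a₁ b₁)
    (h₂ : ReducedSolution R k B₂ c₂ L y₂ Z₂ a₂ b₂) (hc : c₂ ≤ c₁)
    (hB : ∀ q > 0, 0 < (1 - R) * (c₁ - c₂) * q + (B₂ - B₁)) {x e : ℝ} (hxe : x < e)
    (hs₁ : a₁ ≤ x) (hs₂ : a₂ ≤ x) (hx₁ : e ≤ b₁) (hx₂ : e ≤ b₂) (he : y₁ e = y₂ e)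
    (hlt : ∀ t ∈ Ico x e, y₂ t < y₁ t) : False := by
  have ev := eventually_N_lt h₁ h₂ hB ⟨hs₁.trans hxe.le, hx₁⟩ ⟨hs₂.trans hxe.le, hx₂⟩ he
  have ev' : ∀ᶠ t in 𝓝[<] e, (1 - R) * (y₁ t + R * t ^ 2 - c₁ * t) + B₁
      < (1 - R) * (y₂ t + R * t ^ 2 - c₂ * t) + B₂ := by
    refine ev.filter_mono (nhdsWithin_le_of_mem (mem_of_superset (Ioo_mem_nhdsLT hxe) ?_))
    exact fun t ht => ⟨⟨hs₁.trans ht.1.le, ht.2.le.trans hx₁⟩, hs₂.trans ht.1.le, ht.2.le.trans hx₂⟩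
  obtain ⟨u, hu, huN⟩ := (mem_nhdsLT_iff_exists_Ioo_subset' hxe).1 ev'
  have hu : u < e := hu
  set v := max u x with hv
  have hve : v < e := max_lt hu hxe
  have hxv : x ≤ v := le_max_right _ _
  have sub₁ : Icc v e ⊆ Icc a₁ b₁ := Icc_subset_Icc (hs₁.trans hxv) hx₁
  have sub₂ : Icc v e ⊆ Icc a₂ b₂ := Icc_subset_Icc (hs₂.trans hxv) hx₂
  have cy₁ := h₁.y_cont.mono sub₁
  have cy₂ := h₂.y_cont.mono sub₂
  have cZ₁ := h₁.Z_cont.mono sub₁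
  have cZ₂ := h₂.Z_cont.mono sub₂
  -- a Lipschitz bound for the right-hand side along the two solutions
  obtain ⟨C, hC⟩ : ∃ C, ∀ t ∈ Icc v e, t / R * ((1 - R) * (y₁ t + R * t ^ 2 - c₁ * t) + B₁)
      * (2 * ((2 * R + Z₁ t) * (2 * R + Z₂ t)) / (2 * R ^ 2 * k
        * ((2 * t - (1 - t) * Z₁ t) * (2 * t - (1 - t) * Z₂ t)))) ≤ C := by
    refine (isCompact_Icc.exists_bound_of_continuousOn (f := fun t => t / R *
      ((1 - R) * (y₁ t + R * t ^ 2 - c₁ * t) + B₁)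
      * (2 * ((2 * R + Z₁ t) * (2 * R + Z₂ t)) / (2 * R ^ 2 * k
        * ((2 * t - (1 - t) * Z₁ t) * (2 * t - (1 - t) * Z₂ t))))) ?_).imp
        fun C hC t ht => (le_abs_self _).trans (hC t ht)
    refine ContinuousOn.mul (by fun_prop) (ContinuousOn.div (by fun_prop) (by fun_prop) ?_)
    intro t ht
    have := h₁.den_pos t (sub₁ ht)
    have := h₂.den_pos t (sub₂ ht)
    positivity
  -- Here the rates are ordered against `N₁ < N₂`, so the sign of the derivative is open. Grönwall's
  -- argument replaces it: the derivative of `y₁ - y₂` is at least `-C (y₁ - y₂)`.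
  have hmono : MonotoneOn (fun q => (y₁ q - y₂ q) * Real.exp (C * q)) (Icc v e) := by
    have hD : ∀ t ∈ Ioo v e, HasDerivAt (fun q => (y₁ q - y₂ q) * Real.exp (C * q))
        ((t / R * (((1 - R) * (y₂ t + R * t ^ 2 - c₂ * t) + B₂) * rate t (Z₂ t)
        - ((1 - R) * (y₁ t + R * t ^ 2 - c₁ * t) + B₁) * rate t (Z₁ t)) + (c₁ - c₂))
          * Real.exp (C * t) + (y₁ t - y₂ t) * (Real.exp (C * t) * (C * 1))) t := by
      intro t ht
      have ht₁ : t ∈ Ioo a₁ b₁ := ⟨(hs₁.trans hxv).trans_lt ht.1, ht.2.trans_le hx₁⟩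
      have ht₂ : t ∈ Ioo a₂ b₂ := ⟨(hs₂.trans hxv).trans_lt ht.1, ht.2.trans_le hx₂⟩
      exact (hasDerivAt_sub h₁ h₂ ht₁ ht₂).mul ((hasDerivAt_id t).const_mul C).exp
    refine monotoneOn_of_deriv_nonneg (convex_Icc _ _) (by fun_prop) ?_ fun t ht => ?_
    · intro t ht
      rw [interior_Icc] at ht
      exact (hD t ht).differentiableAt.differentiableWithinAt
    rw [interior_Icc] at ht
    rw [(hD t ht).deriv]
    have i₁ := sub₁ (Ioo_subset_Icc_self ht)
    have i₂ := sub₂ (Ioo_subset_Icc_self ht)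
    have hN := huN ⟨(le_max_left _ _).trans_lt ht.1, ht.2⟩
    simp only [mem_ofPred_eq] at hN
    have hC' := hC t (Ioo_subset_Icc_self ht)
    have hy := hlt t ⟨hxv.trans ht.1.le, ht.2⟩
    have hZ := (Z_lt_Z_iff hR hk h₂ h₁ i₂ i₁).2 hy
    have p1 := h₁.Z_gt t i₁
    have p2 := h₂.Z_gt t i₂
    have p3 := h₁.den_pos t i₁
    have p4 := h₂.den_pos t i₂
    have hq := h₁.q_pos i₁
    have hN1 := h₁.N_pos t i₁
    have hr2 := h₂.rate_nonneg hR hk i₂ (h₂.y_nonneg hR hk i₂)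
    have hrs := rate_sub hq p3 p4
    have hcs := coord_sub (k := k) (q := t) p1 p2
    rw [← h₁.rel t i₁, ← h₂.rel t i₂] at hcs
    set N₁ := (1 - R) * (y₁ t + R * t ^ 2 - c₁ * t) + B₁
    set N₂ := (1 - R) * (y₂ t + R * t ^ 2 - c₂ * t) + B₂
    have hZd : Z₁ t - Z₂ t ≤ (y₁ t - y₂ t) * ((2 * R + Z₁ t) * (2 * R + Z₂ t)) / (2 * R ^ 2 * k) := by
      rw [le_div_iff₀ (by positivity), hcs]
      have e1 : (Z₁ t - Z₂ t) * ((1 - t) ^ 2 / 2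
          + 2 * R ^ 2 * k / ((2 * R + Z₁ t) * (2 * R + Z₂ t)))
          * ((2 * R + Z₁ t) * (2 * R + Z₂ t)) = (Z₁ t - Z₂ t) * (2 * R ^ 2 * k)
          + (Z₁ t - Z₂ t) * ((1 - t) ^ 2 / 2) * ((2 * R + Z₁ t) * (2 * R + Z₂ t)) := by
        field_simp
        ring
      rw [e1]
      have : 0 ≤ (Z₁ t - Z₂ t) * ((1 - t) ^ 2 / 2) * ((2 * R + Z₁ t) * (2 * R + Z₂ t)) := by
        have := (sub_pos.2 hZ).le
        positivity
      linarith
    have hrd : rate t (Z₁ t) - rate t (Z₂ t) ≤ (y₁ t - y₂ t) *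
        (2 * ((2 * R + Z₁ t) * (2 * R + Z₂ t)) / (2 * R ^ 2 * k
        * ((2 * t - (1 - t) * Z₁ t) * (2 * t - (1 - t) * Z₂ t)))) := by
      rw [hrs]
      calc 2 * (Z₁ t - Z₂ t) / ((2 * t - (1 - t) * Z₁ t) * (2 * t - (1 - t) * Z₂ t))
          ≤ 2 * ((y₁ t - y₂ t) * ((2 * R + Z₁ t) * (2 * R + Z₂ t)) / (2 * R ^ 2 * k))
            / ((2 * t - (1 - t) * Z₁ t) * (2 * t - (1 - t) * Z₂ t)) := by gcongr
        _ = _ := by field_simp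
    have key : t / R * N₁ * (rate t (Z₁ t) - rate t (Z₂ t)) ≤ C * (y₁ t - y₂ t) := by
      calc _ ≤ t / R * N₁ * ((y₁ t - y₂ t) * _) := by gcongr
        _ = (t / R * N₁ * _) * (y₁ t - y₂ t) := by ring
        _ ≤ C * (y₁ t - y₂ t) := mul_le_mul_of_nonneg_right hC' (sub_pos.2 hy).le
    have key2 : 0 ≤ t / R * ((N₂ - N₁) * rate t (Z₂ t)) := by
      have := (sub_pos.2 hN).le
      positivity
    have hexp := Real.exp_pos (C * t)
    have : 0 ≤ t / R * (N₂ * rate t (Z₂ t) - N₁ * rate t (Z₁ t)) + (c₁ - c₂)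
        + C * (y₁ t - y₂ t) := by
      have : t / R * (N₂ * rate t (Z₂ t) - N₁ * rate t (Z₁ t))
        = t / R * ((N₂ - N₁) * rate t (Z₂ t))
          - t / R * N₁ * (rate t (Z₁ t) - rate t (Z₂ t)) := by ring
      linarith
    have := mul_nonneg this hexp.le
    linarith
  have hle := hmono (left_mem_Icc.2 hve.le) (right_mem_Icc.2 hve.le) hve.le
  have h3 := mul_pos (sub_pos.2 (hlt v ⟨hxv, hve⟩)) (Real.exp_pos (C * v))
  simp only [he, sub_self, zero_mul] at hle
  linarith

/-- Subtracting the equations of equal solutions leaves a positive multiple of `rate` plus `c₁ -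
c₂`, which cannot vanish as `rate > 0` in the interior. -/
lemma not_eqOn (hR : 0 < R) (hk : 0 < k) (h₁ : ReducedSolution R k B₁ c₁ L y₁ Z₁ a₁ b₁)
    (h₂ : ReducedSolution R k B₂ c₂ L y₂ Z₂ a₂ b₂) (hc : c₂ ≤ c₁)
    (hB : ∀ q > 0, 0 < (1 - R) * (c₁ - c₂) * q + (B₂ - B₁)) {s x : ℝ} (hsx : s < x)
    (hs₁ : a₁ ≤ s) (hs₂ : a₂ ≤ s) (hx₁ : x ≤ b₁) (hx₂ : x ≤ b₂) :
    ¬ ∀ t ∈ Icc s x, y₁ t = y₂ t := by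
  intro heq
  obtain ⟨t, ht⟩ := exists_between hsx
  have ht₁ : t ∈ Ioo a₁ b₁ := ⟨hs₁.trans_lt ht.1, ht.2.trans_le hx₁⟩
  have ht₂ : t ∈ Ioo a₂ b₂ := ⟨hs₂.trans_lt ht.1, ht.2.trans_le hx₂⟩
  have i₁ := Ioo_subset_Icc_self ht₁
  have i₂ := Ioo_subset_Icc_self ht₂
  have hd := hasDerivAt_sub h₁ h₂ ht₁ ht₂
  have h0 : HasDerivAt (fun q => y₁ q - y₂ q) 0 t := by
    refine (hasDerivAt_const t (0 : ℝ)).congr_of_eventuallyEq ?_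
    filter_upwards [Icc_mem_nhds ht.1 ht.2] with q hq
    rw [heq q hq, sub_self]
  have := hd.unique h0
  have hy := heq t ⟨ht.1.le, ht.2.le⟩
  have hr := h₂.rate_pos hR hk i₂ (h₂.y_pos hR hk ht₂)
  have hq := h₁.q_pos i₁
  rw [rate_eq_rate_of_eq hR hk h₁ h₂ i₁ i₂ hy, hy] at this
  have hp := mul_pos (mul_pos (div_pos hq hR) hr) (hB t hq)
  have e : t / R * (((1 - R) * (y₂ t + R * t ^ 2 - c₂ * t) + B₂) * rate t (Z₂ t)
        - ((1 - R) * (y₂ t + R * t ^ 2 - c₁ * t) + B₁) * rate t (Z₂ t)) + (c₁ - c₂)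
      = t / R * rate t (Z₂ t) * ((1 - R) * (c₁ - c₂) * t + (B₂ - B₁)) + (c₁ - c₂) := by ring
  rw [e] at this
  linarith

/-- Two solutions with the same transaction cost that are nested and ordered agree on the smaller
interval. -/
lemma eqOn_of_nested {B₁ c₁ B₂ c₂ : ℝ} {y₁ Z₁ y₂ Z₂ : ℝ → ℝ} {a₁ b₁ a₂ b₂ : ℝ}
    (hR : 0 < R) (hk : 0 < k) (h₁ : ReducedSolution R k B₁ c₁ L y₁ Z₁ a₁ b₁)
    (h₂ : ReducedSolution R k B₂ c₂ L y₂ Z₂ a₂ b₂) (ha : a₁ ≤ a₂) (hb : b₂ ≤ b₁)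
    (hle : ∀ t ∈ Icc a₂ b₂, y₂ t ≤ y₁ t) : ∀ t ∈ Icc a₂ b₂, y₁ t = y₂ t := by
  intro t ht
  have hsub : Icc a₂ b₂ ⊆ Icc a₁ b₁ := Icc_subset_Icc ha hb
  by_contra hne
  have hlt : y₂ t < y₁ t := lt_of_le_of_ne (hle t ht) (Ne.symm hne)
  have hI := intervalIntegral.integral_lt_integral_of_continuousOn_of_le_of_exists_lt h₂.a_lt_b
    h₂.rate_cont (h₁.rate_cont.mono hsub)
    (fun x hx => rate_le_rate_of_le hR hk h₂ h₁ (Ioc_subset_Icc_self hx)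
      (hsub (Ioc_subset_Icc_self hx)) (hle x (Ioc_subset_Icc_self hx)))
    ⟨t, ht, rate_lt_rate_of_lt hR hk h₂ h₁ ht (hsub ht) hlt⟩
  -- A strict inequality somewhere makes the cost on the smaller interval strictly larger; since
  -- `rate ≥ 0`, enlarging the interval cannot undo this.
  have hI' : ∫ q in a₂..b₂, rate q (Z₁ q) ≤ ∫ q in a₁..b₁, rate q (Z₁ q) := by
    refine intervalIntegral.integral_mono_interval ha h₂.a_lt_b.le hb ?_
      (h₁.rate_cont.intervalIntegrable_of_Icc h₁.a_lt_b.le)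
    filter_upwards [MeasureTheory.ae_restrict_mem measurableSet_Ioc] with x hx
    have hx := Ioc_subset_Icc_self hx
    exact h₁.rate_nonneg hR hk hx (h₁.y_nonneg hR hk hx)
  linarith [h₁.cost, h₂.cost]

theorem left_lt_left (hR : 0 < R) (hk : 0 < k) (h₁ : ReducedSolution R k B₁ c₁ L y₁ Z₁ a₁ b₁)
    (h₂ : ReducedSolution R k B₂ c₂ L y₂ Z₂ a₂ b₂) (hc : c₂ ≤ c₁)
    (hB : ∀ q > 0, 0 < (1 - R) * (c₁ - c₂) * q + (B₂ - B₁)) : a₂ < a₁ := by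
  by_contra! ha
  -- The intervals overlap because `2 R a₂ < c₂ ≤ c₁ ≤ 2 R b₁`.
  have hab : a₂ < b₁ := by
    have := h₂.left_lt hR hk
    have := h₁.le_right hR hk
    by_contra! h
    nlinarith
  have main : ∀ x ∈ Icc a₂ (min b₁ b₂), y₂ x ≤ y₁ x := by
    intro x hx
    by_contra! hlt
    have hx₁ := hx.2.trans (min_le_left _ _)
    have hx₂ := hx.2.trans (min_le_right _ _)
    obtain ⟨s, hs, hs0, hs'⟩ := exists_last_zero (f := fun t => y₁ t - y₂ t) hx.1
      ((h₁.y_cont.mono (Icc_subset_Icc ha hx₁)).sub (h₂.y_cont.mono (Icc_subset_Icc_right hx₂)))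
      (by simpa [h₂.left] using h₁.y_nonneg hR hk ⟨ha, hab.le⟩) (sub_neg.2 hlt)
    exact no_crossing_right hR hk h₁ h₂ hc hB hs.2 (ha.trans hs.1) hs.1 hx₁ hx₂ (sub_eq_zero.1 hs0)
      fun t ht => sub_neg.1 (hs' t ht)
  have hb : b₂ ≤ b₁ := by
    by_contra! hb
    have := main b₁ ⟨hab.le, by simp [hb.le]⟩
    have := h₂.y_pos hR hk ⟨hab, hb⟩
    linarith [h₁.right]
  rw [min_eq_right hb] at main
  exact not_eqOn hR hk h₁ h₂ hc hB h₂.a_lt_b ha le_rfl hb le_rfl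
    (eqOn_of_nested hR hk h₁ h₂ ha hb main)

theorem right_lt_right (hR : 0 < R) (hk : 0 < k) (h₁ : ReducedSolution R k B₁ c₁ L y₁ Z₁ a₁ b₁)
    (h₂ : ReducedSolution R k B₂ c₂ L y₂ Z₂ a₂ b₂) (hc : c₂ ≤ c₁)
    (hB : ∀ q > 0, 0 < (1 - R) * (c₁ - c₂) * q + (B₂ - B₁)) : b₂ < b₁ := by
  by_contra! hb
  have ha := (left_lt_left hR hk h₁ h₂ hc hB).le
  have main : ∀ x ∈ Icc a₁ b₁, y₁ x ≤ y₂ x := by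
    intro x hx
    by_contra! hlt
    obtain ⟨e, he, he0, he'⟩ := exists_first_zero (f := fun t => y₂ t - y₁ t) hx.2
      ((h₂.y_cont.mono (Icc_subset_Icc (ha.trans hx.1) hb)).sub
        (h₁.y_cont.mono (Icc_subset_Icc_left hx.1)))
      (sub_neg.2 hlt)
      (by simpa [h₁.right] using h₂.y_nonneg hR hk ⟨ha.trans h₁.a_lt_b.le, hb⟩)
    exact no_crossing_left hR hk h₁ h₂ hc hB he.1 hx.1 (ha.trans hx.1) he.2 (he.2.trans hb)
      (sub_eq_zero.1 he0).symm fun t ht => sub_neg.1 (he' t ht)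
  exact not_eqOn hR hk h₁ h₂ hc hB h₁.a_lt_b le_rfl ha le_rfl hb
    fun t ht => (eqOn_of_nested hR hk h₂ h₁ ha hb main t ht).symm

end Compare

/-! ### From the original problem to the reduced one. -/

/-- `φ / (1 - R)` as a function of `q` and `y = b₁ (n - m) / (1 - R)`. -/
def psi (R k q y : ℝ) : ℝ := y + R * (1 - q) ^ 2 - k * R

/-- The denominator in the rationalised form of `(φ + √(φ² + E²)) / (1 - q)²`. -/
noncomputable def gap (R k q y : ℝ) : ℝ :=
  √(psi R k q y ^ 2 + 4 * R ^ 2 * k * (1 - q) ^ 2) - psi R k q y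

/-- The rationalised form stays regular at `q = 1` when `y < k R`, which is where `O` extends
(`yCoord_one_lt_iff`). -/
noncomputable def zCoord (R k q y : ℝ) : ℝ := 4 * R ^ 2 * k / gap R k q y - 2 * R

lemma gap_pos {R k q y : ℝ} (hR : 0 < R) (hk : 0 < k) (h : q ≠ 1 ∨ y < k * R) :
    0 < gap R k q y := by
  unfold gap
  rw [sub_pos]
  rcases h with h | h
  · refine Real.lt_sqrt_of_sq_lt ?_
    have : 1 - q ≠ 0 := sub_ne_zero.2 h.symm
    have : 0 < 4 * R ^ 2 * k * (1 - q) ^ 2 := by positivity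
    linarith
  · by_cases hq : q = 1
    · subst hq
      refine lt_of_lt_of_le ?_ (Real.sqrt_nonneg _)
      simp only [psi]
      linarith
    · refine Real.lt_sqrt_of_sq_lt ?_
      have : 1 - q ≠ 0 := sub_ne_zero.2 (Ne.symm hq)
      have : 0 < 4 * R ^ 2 * k * (1 - q) ^ 2 := by positivity
      linarith

lemma zCoord_gt {R k q y : ℝ} (hR : 0 < R) (hk : 0 < k) (h : 0 < gap R k q y) :
    0 < 2 * R + zCoord R k q y := by
  unfold zCoord
  have : 0 < 4 * R ^ 2 * k / gap R k q y := by positivity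
  linarith

lemma gap_sq {R k q y : ℝ} (hk : 0 < k) :
    gap R k q y ^ 2 + 2 * psi R k q y * gap R k q y = 4 * R ^ 2 * k * (1 - q) ^ 2 := by
  unfold gap
  have := Real.sq_sqrt (show 0 ≤ psi R k q y ^ 2 + 4 * R ^ 2 * k * (1 - q) ^ 2 by positivity)
  linear_combination this

lemma psi_add_sqrt {R k q y : ℝ} (hk : 0 < k) (h : 0 < gap R k q y) :
    psi R k q y + √(psi R k q y ^ 2 + 4 * R ^ 2 * k * (1 - q) ^ 2)
      = (1 - q) ^ 2 * (2 * R + zCoord R k q y) := by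
  have h1 : psi R k q y + √(psi R k q y ^ 2 + 4 * R ^ 2 * k * (1 - q) ^ 2)
      = gap R k q y + 2 * psi R k q y := by unfold gap; ring
  rw [h1]
  unfold zCoord
  field_simp
  linear_combination gap_sq (R := R) (q := q) (y := y) hk

lemma eq_zCoord {R k q y : ℝ} (hR : 0 < R) (hk : 0 < k) (h : 0 < gap R k q y) :
    y = (1 - q) ^ 2 * zCoord R k q y / 2
      + R * k * (zCoord R k q y / (2 * R + zCoord R k q y)) := by
  have h1 := gap_sq (R := R) (q := q) (y := y) hk
  have h2 : 2 * R + zCoord R k q y = 4 * R ^ 2 * k / gap R k q y := by unfold zCoord; ring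
  rw [h2]
  unfold zCoord
  have h3 : y = psi R k q y - R * (1 - q) ^ 2 + k * R := by unfold psi; ring
  nth_rewrite 1 [h3]
  field_simp
  linear_combination 4 * h1

namespace Params

variable (P : Params)

/-- The coordinate `b₁ (n - m) / (1 - R)`. -/
noncomputable def yCoord (n q : ℝ) : ℝ :=
  P.b₁ * (n - 1) / (1 - P.R) - P.R * q ^ 2 + P.b₃ * q

/-- Absorbs `sgn (1 - R)`, so that `R < 1` and `R > 1` share one formula. -/
lemma sign_mul_sqrt (r x : ℝ) : Real.sign r * √(r ^ 2 * x) = r * √x := by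
  rw [Real.sqrt_mul (sq_nonneg r), Real.sqrt_sq_eq_abs, ← mul_assoc]
  congr 1
  rcases lt_trichotomy r 0 with h | h | h
  · rw [Real.sign_of_neg h, abs_of_neg h]; ring
  · simp [h]
  · rw [Real.sign_of_pos h, abs_of_pos h]; ring

variable {P}

lemma denomO_eq (hS : P.Standing) {q n : ℝ} (h : 0 < gap P.R (P.b₂ - 1) q (P.yCoord n q)) :
    P.denomO q n = (1 - P.R) * (1 - q) *
      (2 * q - (1 - q) * zCoord P.R (P.b₂ - 1) q (P.yCoord n q)) := by
  have hR1 : 1 - P.R ≠ 0 := sub_ne_zero.2 hS.R_ne_one.symm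
  have hk : 0 < P.b₂ - 1 := sub_pos.2 hS.b₂_gt
  have hφ : P.φ q n = (1 - P.R) * psi P.R (P.b₂ - 1) q (P.yCoord n q) := by
    unfold φ psi yCoord
    field_simp
    ring
  have hs := psi_add_sqrt hk h
  unfold denomO
  rw [hφ]
  have e : ((1 - P.R) * psi P.R (P.b₂ - 1) q (P.yCoord n q)) ^ 2 + P.Esq q
      = (1 - P.R) ^ 2 * (psi P.R (P.b₂ - 1) q (P.yCoord n q) ^ 2
        + 4 * P.R ^ 2 * (P.b₂ - 1) * (1 - q) ^ 2) := by
    unfold Esq; ring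
  rw [e, sign_mul_sqrt]
  linear_combination (-(1 - P.R)) * hs

/-- The factor `1 - q` of `denomO` makes the poles of the two fractions at `q = 1` cancel. -/
lemma formulaO_eq (hS : P.Standing) {q n : ℝ} (hq : 0 < q) (hq1 : q ≠ 1)
    (hd : 2 * q - (1 - q) * zCoord P.R (P.b₂ - 1) q (P.yCoord n q) ≠ 0) :
    P.formulaO q n = -(q * (1 - P.R) / P.R * n
      * rate q (zCoord P.R (P.b₂ - 1) q (P.yCoord n q))) := by
  have hR1 : 1 - P.R ≠ 0 := sub_ne_zero.2 hS.R_ne_one.symm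
  have hk : 0 < P.b₂ - 1 := sub_pos.2 hS.b₂_gt
  have hR := hS.R_pos
  have h1 : 1 - q ≠ 0 := sub_ne_zero.2 hq1.symm
  unfold formulaO rate
  rw [denomO_eq hS (gap_pos hR hk (Or.inl hq1))]
  generalize zCoord P.R (P.b₂ - 1) q (P.yCoord n q) = z at hd ⊢
  obtain ⟨D, hD⟩ : ∃ D, D = 2 * q - (1 - q) * z := ⟨_, rfl⟩
  rw [← hD] at hd ⊢
  field_simp
  rw [hD]
  ring

lemma continuousAt_zCoord_one (hS : P.Standing) {n : ℝ}
    (h : P.yCoord n 1 < (P.b₂ - 1) * P.R) :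
    ContinuousAt (fun x => zCoord P.R (P.b₂ - 1) x (P.yCoord n x)) 1 := by
  have hg := gap_pos hS.R_pos (sub_pos.2 hS.b₂_gt) (q := 1) (Or.inr h)
  unfold zCoord
  refine ContinuousAt.sub (ContinuousAt.div continuousAt_const ?_ hg.ne') continuousAt_const
  unfold gap psi yCoord
  fun_prop

lemma tendsto_formulaO_one (hS : P.Standing) {n : ℝ}
    (h : P.yCoord n 1 < (P.b₂ - 1) * P.R) :
    Tendsto (fun x => P.formulaO x n) (𝓝[≠] 1) (𝓝 (-(1 * (1 - P.R) / P.R * n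
      * rate 1 (zCoord P.R (P.b₂ - 1) 1 (P.yCoord n 1))))) := by
  have hz := continuousAt_zCoord_one hS h
  have hd : ContinuousAt
      (fun x => 2 * x - (1 - x) * zCoord P.R (P.b₂ - 1) x (P.yCoord n x)) 1 := by fun_prop
  have hc : ContinuousAt (fun x => -(x * (1 - P.R) / P.R * n
      * rate x (zCoord P.R (P.b₂ - 1) x (P.yCoord n x)))) 1 := by
    have : ContinuousAt (fun x => rate x (zCoord P.R (P.b₂ - 1) x (P.yCoord n x))) 1 := by
      unfold rate
      exact hz.div (continuousAt_id.mul hd) (by norm_num)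
    fun_prop
  refine (hc.tendsto.mono_left nhdsWithin_le_nhds).congr' ?_
  have hd0 := hd.eventually_ne (y := 0) (by norm_num)
  filter_upwards [self_mem_nhdsWithin, hd0.filter_mono nhdsWithin_le_nhds,
    (lt_mem_nhds (zero_lt_one' ℝ)).filter_mono nhdsWithin_le_nhds] with x h1 h2 h3
  exact (formulaO_eq hS h3 h1 h2).symm

lemma yCoord_one_lt_iff (hS : P.Standing) {n : ℝ} :
    P.yCoord n 1 < (P.b₂ - 1) * P.R ↔ (1 - P.R) * n < (1 - P.R) * P.ell 1 := by
  have hR1 : 1 - P.R ≠ 0 := sub_ne_zero.2 hS.R_ne_one.symm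
  have hb := hS.b₁_pos
  have hR := hS.R_pos
  have e : (1 - P.R) * n - (1 - P.R) * P.ell 1
      = (1 - P.R) ^ 2 / P.b₁ * (P.yCoord n 1 - (P.b₂ - 1) * P.R) := by
    unfold ell m yCoord
    field_simp
    ring
  have hp : 0 < (1 - P.R) ^ 2 / P.b₁ := by positivity
  rw [← sub_neg (b := (1 - P.R) * P.ell 1), e, ← sub_neg (b := (P.b₂ - 1) * P.R)]
  exact ⟨fun h => mul_neg_of_pos_of_neg hp h, fun h => by
    by_contra! h'
    linarith [mul_nonneg hp.le h']⟩

lemma DefinedO.gap_pos (hS : P.Standing) {q n : ℝ} (h : P.DefinedO q n) :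
    0 < gap P.R (P.b₂ - 1) q (P.yCoord n q) := by
  refine IlliquidAsset.gap_pos hS.R_pos (sub_pos.2 hS.b₂_gt) ?_
  rcases h with h | ⟨rfl, h⟩
  · exact Or.inl h.1
  · exact Or.inr ((yCoord_one_lt_iff hS).2 h)

lemma DefinedO.den_ne_zero (hS : P.Standing) {q n : ℝ} (h : P.DefinedO q n) :
    2 * q - (1 - q) * zCoord P.R (P.b₂ - 1) q (P.yCoord n q) ≠ 0 := by
  have hg := h.gap_pos hS
  rcases h with h | ⟨rfl, h⟩
  · intro h0
    exact h.2 (by rw [denomO_eq hS hg, h0, mul_zero])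
  · norm_num

lemma DefinedO.O_eq (hS : P.Standing) {q n : ℝ} (hq : 0 < q) (h : P.DefinedO q n) :
    P.O q n = -(q * (1 - P.R) / P.R * n
      * rate q (zCoord P.R (P.b₂ - 1) q (P.yCoord n q))) := by
  unfold O
  split_ifs with h1
  · subst h1
    have : (1 - P.R) * n < (1 - P.R) * P.ell 1 := by simpa [DefinedO] using h
    exact (tendsto_formulaO_one hS ((yCoord_one_lt_iff hS).2 this)).limUnder_eq
  · exact formulaO_eq hS hq h1 (h.den_ne_zero hS)

lemma yCoord_m (hS : P.Standing) (q : ℝ) : P.yCoord (P.m q) q = 0 := by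
  have hR1 : 1 - P.R ≠ 0 := sub_ne_zero.2 hS.R_ne_one.symm
  have hb := hS.b₁_pos
  unfold yCoord m
  field_simp
  ring

lemma zCoord_zero {R k q : ℝ} (hR : 0 < R) (hk : 0 < k) (h : 0 < gap R k q 0) :
    zCoord R k q 0 = 0 := by
  have h1 := eq_zCoord hR hk h
  have h2 := zCoord_gt hR hk h
  have h3 : zCoord R k q 0 * ((1 - q) ^ 2 / 2 + R * k / (2 * R + zCoord R k q 0)) = 0 := by
    linear_combination -h1
  exact (mul_eq_zero.1 h3).resolve_right (by positivity)

lemma yCoord_N (hS : P.Standing) (n q : ℝ) :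
    (1 - P.R) * (P.yCoord n q + P.R * q ^ 2 - P.b₃ * q) + P.b₁ = P.b₁ * n := by
  have hR1 : 1 - P.R ≠ 0 := sub_ne_zero.2 hS.R_ne_one.symm
  unfold yCoord
  field_simp
  ring

theorem IsFreeBoundarySolution.reduced (hS : P.Standing) {n : ℝ → ℝ} {ql qu : ℝ}
    (h : P.IsFreeBoundarySolution n ql qu) :
    ReducedSolution P.R (P.b₂ - 1) P.b₁ P.b₃ (Real.log (1 + P.ξ)) (fun q => P.yCoord (n q) q)
      (fun q => zCoord P.R (P.b₂ - 1) q (P.yCoord (n q) q)) ql qu := by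
  have hR := hS.R_pos
  have hR1 : 1 - P.R ≠ 0 := sub_ne_zero.2 hS.R_ne_one.symm
  have hb := hS.b₁_pos
  have hk : 0 < P.b₂ - 1 := sub_pos.2 hS.b₂_gt
  have hpos : ∀ q ∈ Icc ql qu, 0 < q := fun q hq => h.ql_pos.trans_le hq.1
  have hn : ContinuousOn n (Icc ql qu) := fun q hq => (h.ode q hq).continuousWithinAt
  have hgap : ∀ q ∈ Icc ql qu, 0 < gap P.R (P.b₂ - 1) q (P.yCoord (n q) q) :=
    fun q hq => (h.definedO q hq).gap_pos hS
  have hZ : ContinuousOn (fun q => zCoord P.R (P.b₂ - 1) q (P.yCoord (n q) q)) (Icc ql qu) := by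
    unfold zCoord
    refine ContinuousOn.sub (ContinuousOn.div continuousOn_const ?_ fun q hq => (hgap q hq).ne')
      continuousOn_const
    unfold gap psi yCoord
    fun_prop
  have hleft : P.yCoord (n ql) ql = 0 := by rw [h.left_boundary, yCoord_m hS]
  have hl : ql ∈ Icc ql qu := left_mem_Icc.2 h.ql_lt_qu.le
  -- The expression never vanishes where `O` is defined, and equals `2 ql > 0` at `ql`, where `Z =
  -- 0`.
  have hden : ∀ q ∈ Icc ql qu,
      0 < 2 * q - (1 - q) * zCoord P.R (P.b₂ - 1) q (P.yCoord (n q) q) := by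
    intro q hq
    by_contra! hneg
    have hc : ContinuousOn (fun q => 2 * q - (1 - q) * zCoord P.R (P.b₂ - 1) q (P.yCoord (n q) q))
      (Icc ql qu) := by fun_prop
    obtain ⟨t, ht, ht0⟩ := intermediate_value_Icc' hq.1 (hc.mono (Icc_subset_Icc_right hq.2))
      (show (0 : ℝ) ∈ Icc _ _ from ⟨hneg, by
        have hg := hgap ql hl
        rw [hleft] at hg
        simp only [hleft, zCoord_zero hR hk hg]
        linarith [h.ql_pos]⟩)
    exact (h.definedO t ⟨ht.1, ht.2.trans hq.2⟩).den_ne_zero hS ht0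
  refine ⟨h.ql_pos, h.ql_lt_qu, hZ, fun q hq => zCoord_gt hR hk (hgap q hq),
    fun q hq => eq_zCoord hR hk (hgap q hq), hden, fun q hq => ?_, fun q hq => ?_, hleft, ?_, ?_⟩
  · rw [yCoord_N hS]
    exact mul_pos hb (h.n_pos q hq)
  · rw [yCoord_N hS]
    have h1 := (((((h.ode q hq).sub_const 1).const_mul P.b₁).div_const (1 - P.R)).sub
      ((((hasDerivAt_id q).pow 2).const_mul P.R).hasDerivWithinAt)).add
      (((hasDerivAt_id q).const_mul P.b₃).hasDerivWithinAt)
    refine h1.congr_deriv ?_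
    rw [(h.definedO q hq).O_eq hS (hpos q hq)]
    simp only [id]
    field_simp
    norm_num
    ring
  · rw [h.right_boundary, yCoord_m hS]
  · rw [h.transaction_cost]
    refine intervalIntegral.integral_congr fun q hq => ?_
    rw [uIcc_of_le h.ql_lt_qu.le] at hq
    have := hpos q hq
    have := h.n_pos q hq
    rw [(h.definedO q hq).O_eq hS (hpos q hq)]
    field_simp

/-! ### From the free boundaries to the critical ratios. -/

/-- Only `ql > 1` matters; there the cost bound gives `λ ≤ ξ < 1 / (ql - 1)`. -/
lemma one_add_lam_pos (hS : P.Standing) {n : ℝ → ℝ} {ql qu : ℝ}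
    (h : P.IsFreeBoundarySolution n ql qu) : 0 < 1 + P.lam * (1 - ql) := by
  have hl := hS.lam_nonneg
  rcases le_or_gt ql 1 with h1 | h1
  · have := mul_nonneg hl (sub_nonneg.2 h1)
    linarith
  · have h2 := (h.reduced hS).log_cost_lt h1
    have hγ : 0 < 1 - P.γ := sub_pos.2 hS.γ_lt
    have hξ : P.lam ≤ P.ξ := by
      unfold ξ
      rw [le_div_iff₀ hγ]
      nlinarith [hS.γ_nonneg]
    have hq : 0 < ql - 1 := sub_pos.2 h1
    rw [Real.log_lt_log_iff (by linarith) (div_pos h.ql_pos hq), lt_div_iff₀ hq] at h2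
    nlinarith

lemma purchase_ratio_lt {lam q q' : ℝ} (hl : 0 ≤ lam) (hq : 0 < 1 + lam * (1 - q'))
    (h : q < q') : q / (1 + lam * (1 - q)) < q' / (1 + lam * (1 - q')) := by
  have : 0 < 1 + lam * (1 - q) := by nlinarith
  rw [div_lt_div_iff₀ this hq]
  nlinarith

lemma sale_ratio_lt {γ q q' : ℝ} (h0 : 0 ≤ γ) (h1 : γ < 1) (hq : 0 < q)
    (h : q < q') : q / (1 - γ * (1 - q)) < q' / (1 - γ * (1 - q')) := by
  have e1 : 0 < 1 - γ * (1 - q) := by nlinarith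
  have e2 : 0 < 1 - γ * (1 - q') := by nlinarith
  rw [div_lt_div_iff₀ e1 e2]
  nlinarith

/-- Comparison of the critical ratios of two markets that differ only in `b₁` and `b₃`. -/
theorem criticalRatios_lt {P Q : Params} (hP : P.Standing) (hQ : Q.Standing)
    (hR : P.R = Q.R) (hb₂ : P.b₂ = Q.b₂) (hlam : P.lam = Q.lam) (hγ : P.γ = Q.γ)
    (hc : Q.b₃ ≤ P.b₃)
    (hB : ∀ q > 0, 0 < (1 - P.R) * (P.b₃ - Q.b₃) * q + (Q.b₁ - P.b₁)) {pl pu pl' pu' : ℝ}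
    (h : P.IsCriticalRatios pl pu) (h' : Q.IsCriticalRatios pl' pu') : pl' < pl ∧ pu' < pu := by
  obtain ⟨n, ql, qu, s, rfl, rfl⟩ := h
  obtain ⟨n', ql', qu', s', rfl, rfl⟩ := h'
  have r := s.reduced hP
  have r' := s'.reduced hQ
  have hξ : Q.ξ = P.ξ := by unfold ξ; rw [hlam, hγ]
  rw [← hR, ← hb₂, hξ] at r'
  have hk : 0 < P.b₂ - 1 := sub_pos.2 hP.b₂_gt
  have h1 := left_lt_left hP.R_pos hk r r' hc hB
  have h2 := right_lt_right hP.R_pos hk r r' hc hB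
  rw [← hlam, ← hγ]
  exact ⟨purchase_ratio_lt hP.lam_nonneg (one_add_lam_pos hP s) h1,
    sale_ratio_lt hP.γ_nonneg hP.γ_lt (s'.ql_pos.trans s'.ql_lt_qu) h2⟩

end Params

end IlliquidAsset

theorem corollary6p3 (P : IlliquidAsset.Params) :
    (∀ δ₁ δ₂ pl₁ pu₁ pl₂ pu₂ : ℝ, δ₁ < δ₂ →
      ({P with δ := δ₁} : IlliquidAsset.Params).Standing →
      ({P with δ := δ₂} : IlliquidAsset.Params).Standing →
      ({P with δ := δ₁} : IlliquidAsset.Params).IsCriticalRatios pl₁ pu₁ →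
      ({P with δ := δ₂} : IlliquidAsset.Params).IsCriticalRatios pl₂ pu₂ →
      pl₂ < pl₁ ∧ pu₂ < pu₁) ∧
    (P.R < 1 → ∀ α₁ α₂ pl₁ pu₁ pl₂ pu₂ : ℝ, α₁ < α₂ →
      ({P with α := α₁} : IlliquidAsset.Params).Standing →
      ({P with α := α₂} : IlliquidAsset.Params).Standing →
      ({P with α := α₁} : IlliquidAsset.Params).IsCriticalRatios pl₁ pu₁ →
      ({P with α := α₂} : IlliquidAsset.Params).IsCriticalRatios pl₂ pu₂ →
      pl₁ < pl₂ ∧ pu₁ < pu₂) := by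
  refine ⟨fun δ₁ δ₂ pl₁ pu₁ pl₂ pu₂ hδ hS₁ hS₂ h₁ h₂ => ?_,
    fun hR α₁ α₂ pl₁ pu₁ pl₂ pu₂ hα hS₁ hS₂ h₁ h₂ => ?_⟩
  -- Raising `δ` raises `b₁` and leaves `b₂`, `b₃` unchanged.
  · refine IlliquidAsset.Params.criticalRatios_lt hS₁ hS₂ rfl rfl rfl rfl le_rfl
      (fun q _ => ?_) h₁ h₂
    have hη : 0 < P.η := hS₁.η_pos
    have hρ₁ : -1 < P.ρ := hS₁.ρ_gt
    have hρ₂ : P.ρ < 1 := hS₁.ρ_lt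
    have hd : 0 < P.η ^ 2 * (1 - P.ρ ^ 2) := mul_pos (by positivity) (by nlinarith)
    have hb : ({P with δ := δ₁} : IlliquidAsset.Params).b₁
        < ({P with δ := δ₂} : IlliquidAsset.Params).b₁ := by
      simp only [IlliquidAsset.Params.b₁, IlliquidAsset.Params.β]
      gcongr
    have e : ({P with δ := δ₁} : IlliquidAsset.Params).b₃
        = ({P with δ := δ₂} : IlliquidAsset.Params).b₃ := rfl
    rw [e]
    linarith
  · have hη : 0 < P.η := hS₁.η_pos
    have hρ₁ : -1 < P.ρ := hS₁.ρ_gt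
    have hρ₂ : P.ρ < 1 := hS₁.ρ_lt
    have hd : 0 < P.η * (1 - P.ρ ^ 2) := mul_pos hη (by nlinarith)
    have hb : ({P with α := α₁} : IlliquidAsset.Params).b₃
        < ({P with α := α₂} : IlliquidAsset.Params).b₃ := by
      simp only [IlliquidAsset.Params.b₃, IlliquidAsset.Params.ν, IlliquidAsset.Params.β]
      gcongr
    -- Only `b₃` depends on `α`. The larger drift takes the first role, and `R < 1` makes `(1 - R)
    -- (c₁ - c₂) q` positive.
    refine IlliquidAsset.Params.criticalRatios_lt hS₂ hS₁ rfl rfl rfl rfl hb.le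
      (fun q hq => ?_) h₂ h₁
    have e : ({P with α := α₁} : IlliquidAsset.Params).b₁
        = ({P with α := α₂} : IlliquidAsset.Params).b₁ := rfl
    rw [e, sub_self, add_zero]
    exact mul_pos (mul_pos (sub_pos.2 hR) (sub_pos.2 hb)) hq
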